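/- Let $(A,\mathfrak m,k)$ be a (commutative) Noetherian local ring, and for $n\ge 0$ let $\Omega_n^A(k)$ denote the $n$th syzygy module of $k$ in a minimal free resolution $\cdots\to A^{b_1}\to A^{b_0}\to k\to 0$ of $k$; that is, $\Omega_0^A(k)=k$ and, for $n\ge 1$, $\Omega_n^A(k)$ is the image of $A^{b_n}\to A^{b_{n-1}}$. Let $\Lambda$ be a finite set of non-negative integers, let $j_n\ge 0$ be integers for $n\in\Lambda$, and let $$f:\bigoplus_{n\in\Lambda}\bigl(\Omega_n^A(k)\bigr)^{j_n}\longrightarrow L$$ be a surjective $A$-module homomorphism, where $L\neq 0$ is a maximal Cohen--Macaulay $A$-module (that is, $L$ is finitely generated and $\operatorname{depth}_A L=\dim_A L=\dim A$) of finite injective dimension. Then $A$ is a regular local ring. -/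

import Mathlib

open IsLocalRing

universe u v

/-- A minimal free resolution
`⋯ → A^{b₂} → A^{b₁} → A^{b₀} → M → 0` of a module `M` over a local ring `A`,
by free modules of finite rank. -/
structure MinimalFreeResolution (A : Type u) [CommRing A] [IsLocalRing A]
    (M : Type v) [AddCommGroup M] [Module A M] where
  /-- The rank of the `n`-th free module. -/
  rank : ℕ → ℕ
  /-- The augmentation `A^{b₀} → M`. -/
  aug : (Fin (rank 0) → A) →ₗ[A] M
  /-- The differential `A^{bₙ₊₁} → A^{bₙ}`. -/
  d : ∀ n : ℕ, (Fin (rank (n + 1)) → A) →ₗ[A] (Fin (rank n) → A)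
  aug_surjective : Function.Surjective aug
  exact_zero : Function.Exact (d 0) aug
  exact_succ : ∀ n : ℕ, Function.Exact (d (n + 1)) (d n)
  /-- Minimality: the image of each differential lies in `𝔪 A^{bₙ}`. -/
  minimal : ∀ (n : ℕ) (x : Fin (rank (n + 1)) → A) (i : Fin (rank n)),
    d n x i ∈ maximalIdeal A

/-- The `n`-th syzygy module of `M`: it is `M` for `n = 0`, and the image of
`A^{bₙ} → A^{bₙ₋₁}` in the minimal free resolution for `n ≥ 1`. -/
def MinimalFreeResolution.syzygy {A : Type u} [CommRing A] [IsLocalRing A]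
    {M : Type u} [AddCommGroup M] [Module A M] (F : MinimalFreeResolution A M) :
    ℕ → ModuleCat.{u} A
  | 0 => ModuleCat.of A M
  | n + 1 => ModuleCat.of A (LinearMap.range (F.d n))

/-- A finitely generated module over a local ring has a minimal free cover. -/
theorem exists_minimal_free_cover (A : Type u) [CommRing A] [IsLocalRing A]
    (M : Type v) [AddCommGroup M] [Module A M] [Module.Finite A M] :
    ∃ (b : ℕ) (f : (Fin b → A) →ₗ[A] M), Function.Surjective f ∧
      ∀ x, f x = 0 → ∀ i, x i ∈ maximalIdeal A := by
  classical
  let B := Module.finBasis (ResidueField A) (TensorProduct A (ResidueField A) M)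
  have hs : ∀ i, ∃ m : M, (TensorProduct.mk A (ResidueField A) M 1) m = B i := fun i =>
    TensorProduct.mk_surjective A M (ResidueField A) residue_surjective (B i)
  choose m hm using hs
  refine ⟨_, Fintype.linearCombination A m, ?_, ?_⟩
  · rw [← LinearMap.range_eq_top, Fintype.range_linearCombination]
    exact IsLocalRing.span_eq_top_of_tmul_eq_basis m B hm
  · intro x hx i
    have h0 : ∑ i, (residue A (x i)) • B i = 0 := by
      have := congrArg (TensorProduct.mk A (ResidueField A) M 1) hx
      rw [Fintype.linearCombination_apply, map_sum, map_zero] at this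
      rw [← this]
      refine Finset.sum_congr rfl fun i _ => ?_
      rw [map_smul, hm]
      exact algebraMap_smul (ResidueField A) (x i) (B i)
    have := Fintype.linearIndependent_iff.1 B.linearIndependent _ h0 i
    rwa [residue_eq_zero_iff] at this

/-- Minimal free resolutions of finitely generated modules exist. -/
theorem MinimalFreeResolution.exists_of_finite (A : Type u) [CommRing A] [IsLocalRing A]
    [IsNoetherianRing A] (M : Type v) [AddCommGroup M] [Module A M] [Module.Finite A M] :
    Nonempty (MinimalFreeResolution A M) := by
  obtain ⟨b, f, hf, hker⟩ := exists_minimal_free_cover A M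
  have step : ∀ S : (Σ b : ℕ, Submodule A (Fin b → A)),
      ∃ (c : ℕ) (g : (Fin c → A) →ₗ[A] (Fin S.1 → A)), LinearMap.range g = S.2 ∧
        ∀ x, g x = 0 → ∀ i, x i ∈ maximalIdeal A := by
    intro S
    obtain ⟨c, g, hg, hg'⟩ := exists_minimal_free_cover A S.2
    refine ⟨c, S.2.subtype ∘ₗ g, ?_, fun x hx => hg' x (Subtype.ext hx)⟩
    rw [LinearMap.range_comp, LinearMap.range_eq_top.2 hg, Submodule.map_top,
      Submodule.range_subtype]
  choose c g hg hg' using step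
  let S : ℕ → (Σ b : ℕ, Submodule A (Fin b → A)) := fun n =>
    Nat.rec ⟨b, LinearMap.ker f⟩ (fun _ T => ⟨c T, LinearMap.ker (g T)⟩) n
  have hS : ∀ n, ∀ x ∈ (S n).2, ∀ i, x i ∈ maximalIdeal A := by
    intro n
    cases n with
    | zero => exact fun x hx => hker x hx
    | succ n => exact fun x hx => hg' (S n) x hx
  exact ⟨{
    rank := fun n => (S n).1
    aug := f
    d := fun n => g (S n)
    aug_surjective := hf
    exact_zero := LinearMap.exact_iff.2 (hg (S 0)).symm
    exact_succ := fun n => LinearMap.exact_iff.2 (hg (S (n + 1))).symm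
    minimal := fun n x => hS n _ (by rw [← hg (S n)]; exact ⟨x, rfl⟩) }⟩

/-- The depth of a module over a local ring: the supremum of the lengths of `M`-regular
sequences in the maximal ideal. -/
noncomputable def localDepth (A : Type u) [CommRing A] [IsLocalRing A]
    (M : Type v) [AddCommGroup M] [Module A M] : ℕ∞ :=
  ⨆ (rs : List A) (_ : (∀ r ∈ rs, r ∈ maximalIdeal A) ∧
    RingTheory.Sequence.IsRegular M rs), (rs.length : ℕ∞)

/-- A maximal Cohen-Macaulay module over a Noetherian local ring `A`: a finitely generated
module `M` which is zero or satisfies `depth M = dim M = dim A`. -/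
structure IsMaximalCohenMacaulay (A : Type u) [CommRing A] [IsLocalRing A]
    (M : Type v) [AddCommGroup M] [Module A M] : Prop where
  finite : Module.Finite A M
  depth_eq : Nontrivial M → (localDepth A M : WithBot ℕ∞) = Module.supportDim A M
  dim_eq : Nontrivial M → Module.supportDim A M = ringKrullDim A

/-! Induct on d = dim A to show that 𝔪 has at most d generators. The inductive step passes to A/(x)
and L/xL, with x ∈ 𝔪 \ 𝔪² regular on A and L. Finite injective dimension survives by the snake lemma
(`hasInjectiveDimensionLE_quotSMulTop`), depth by the long exact sequence of Ext(k, -). Being a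
syzygy of k does not survive: modulo x a syzygy becomes a product of syzygies, possibly of different
orders, of k-vector spaces (`IsIteratedSyzygy.exists_prod_reduction`). Hence the induction treats
all modules generated by images of such syzygies.

Such an x exists once depth A > 0. If A had a nonzero socle, k would embed in A, and dimension
shifting would give L a nonzero socle (`ext_one_and_socle_of_depth_zero`), against depth L > 0.

For d = 0 and 𝔪 ≠ 0, choose a ≠ 0 in 𝔪 with 𝔪a = 0. It kills every syzygy, since these are vector
spaces or lie in 𝔪F with F free; so aL = 0. But Ext¹(-, L) vanishes on finite modules, so the map
(a) ≅ k → L sending a to a nonzero socle element y extends to A, and y ∈ aL = 0, a contradiction. -/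

open CategoryTheory Abelian Pointwise

/-! ### Vanishing of Ext and rings of depth zero -/

/-- If `Ext^{r+1}(-, L)` vanishes on finite modules and `Ext^r(k, L) = 0`, then `Ext^r(-, L)`
vanishes on finite modules. -/
theorem subsingleton_ext_of_residueField {A : Type u} [CommRing A] [IsLocalRing A]
    [IsNoetherianRing A] (L : ModuleCat.{u} A) [Module.Finite A L] (r : ℕ)
    (hk : Subsingleton (Ext (ModuleCat.of A (A ⧸ maximalIdeal A)) L r))
    (hr : ∀ N : ModuleCat.{u} A, Module.Finite A N → Subsingleton (Ext N L (r + 1)))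
    (N : Type u) [AddCommGroup N] [Module A N] (hN : Module.Finite A N) :
    Subsingleton (Ext (ModuleCat.of A N) L r) := by
  induction hN using IsNoetherianRing.induction_on_isQuotientEquivQuotientPrime A with
  | subsingleton N =>
    refine ⟨fun a b => ?_⟩
    have h : 𝟙 (ModuleCat.of A N) = 0 := by ext x; exact Subsingleton.elim _ _
    rw [← Ext.mk₀_id_comp a, ← Ext.mk₀_id_comp b, h]
    simp
  | quotient N p e =>
    have hfin : Module.Finite A (A ⧸ p.asIdeal) := inferInstance
    suffices h : Subsingleton (Ext (ModuleCat.of A (A ⧸ p.asIdeal)) L r) by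
      have hid : e.toModuleIso.hom ≫ e.toModuleIso.inv = 𝟙 (ModuleCat.of A N) :=
        e.toModuleIso.hom_inv_id
      refine subsingleton_of_forall_eq 0 fun z => ?_
      rw [← Ext.mk₀_id_comp z, ← hid, ← Ext.mk₀_comp_mk₀_assoc,
        h.elim ((Ext.mk₀ e.toModuleIso.inv).comp z (zero_add r)) 0, Ext.comp_zero]
    by_cases hp : maximalIdeal A ≤ p.asIdeal
    · rwa [← (maximalIdeal.isMaximal A).eq_of_le p.2.ne_top hp]
    obtain ⟨y, hy, hyp⟩ := Set.not_subset.1 hp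
    have hreg : IsSMulRegular (A ⧸ p.asIdeal) y := by
      refine isSMulRegular_iff_right_eq_zero_of_smul.2 fun z hz => ?_
      obtain ⟨z, rfl⟩ := Ideal.Quotient.mk_surjective z
      rw [Algebra.smul_def, Ideal.Quotient.algebraMap_eq, ← map_mul,
        Ideal.Quotient.eq_zero_iff_mem] at hz
      exact Ideal.Quotient.eq_zero_iff_mem.2 ((p.2.mem_or_mem hz).resolve_left hyp)
    have hS := IsSMulRegular.smulShortComplex_shortExact
      (M := ModuleCat.of A (A ⧸ p.asIdeal)) hreg
    -- Ext^{r+1}(A/(p, y), L) = 0 makes y ∈ 𝔪 act surjectively on the finite module Ext^r(A/p, L),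
    -- which is then zero by Nakayama.
    have hbot : (⊤ : Submodule A (Ext (ModuleCat.of A (A ⧸ p.asIdeal)) L r)) = ⊥ := by
      refine Submodule.eq_bot_of_le_smul_of_le_jacobson_bot (maximalIdeal A) _
        (Module.Finite.fg_top) ?_ (IsLocalRing.maximalIdeal_le_jacobson _)
      intro z _
      have hr' : Subsingleton (Ext
          (ModuleCat.smulShortComplex (ModuleCat.of A (A ⧸ p.asIdeal)) y).X₃ L (r + 1)) :=
        hr _ (inferInstanceAs (Module.Finite A (QuotSMulTop y (A ⧸ p.asIdeal))))
      obtain ⟨w, rfl⟩ : ∃ w : Ext (ModuleCat.of A (A ⧸ p.asIdeal)) L r,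
          (Ext.mk₀ (y • 𝟙 (ModuleCat.of A (A ⧸ p.asIdeal)))).comp w (zero_add r) = z :=
        Ext.contravariant_sequence_exact₁ hS L z (add_comm 1 r) (hr'.elim _ _)
      rw [Ext.mk₀_smul, Ext.smul_comp, Ext.mk₀_id_comp]
      exact Submodule.smul_mem_smul hy trivial
    exact (Submodule.subsingleton_iff A).1 (subsingleton_of_bot_eq_top hbot.symm)
  | exact N₁ N₂ N₃ f g hf hg hfg h₁ h₃ =>
    refine subsingleton_of_forall_eq 0 fun z => ?_
    have hS := ModuleCat.shortComplex_shortExact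
      (ModuleCat.shortComplexOfCompEqZero f g hfg.linearMap_comp_eq_zero) hfg hf hg
    obtain ⟨w, rfl⟩ := Ext.contravariant_sequence_exact₂ hS L z (h₁.elim _ _)
    have : w = 0 := h₃.elim _ _
    rw [this, Ext.comp_zero]

/-- A finite nonzero module of finite injective dimension over a local ring of depth zero has
nonzero socle and vanishing higher `Ext` on finite modules. -/
theorem ext_one_and_socle_of_depth_zero {A : Type u} [CommRing A] [IsLocalRing A]
    [IsNoetherianRing A] (L : ModuleCat.{u} A) [Module.Finite A L] [Nontrivial L] (n : ℕ)
    [HasInjectiveDimensionLT L n] (a : A) (ha : a ≠ 0) (hma : ∀ y ∈ maximalIdeal A, y * a = 0) :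
    (∀ N : ModuleCat.{u} A, Module.Finite A N → Subsingleton (Ext N L 1)) ∧
      ∃ y : L, y ≠ 0 ∧ ∀ m ∈ maximalIdeal A, m • y = 0 := by
  have hker : maximalIdeal A ≤ LinearMap.ker (LinearMap.toSpanSingleton A A a) :=
    fun y hy => by simpa using hma y hy
  let ι : (A ⧸ maximalIdeal A) →ₗ[A] A := Submodule.liftQ _ _ hker
  have hι : Function.Injective ι := by
    rw [← LinearMap.ker_eq_bot, Submodule.ker_liftQ_eq_bot' _ _ _]
    refine le_antisymm hker (IsLocalRing.le_maximalIdeal ?_)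
    intro h
    have : (1 : A) ∈ LinearMap.ker (LinearMap.toSpanSingleton A A a) := h ▸ trivial
    exact ha (by simpa using this)
  -- `ι` embeds k in A. Ext^{r+1}(k, L) sits between Ext^{r+1}(A, L) = 0 and Ext^{r+2}(A/k, L) = 0,
  -- so vanishing descends one degree at a time, down to degree 1.
  have hone : ∀ r : ℕ, (∀ N : ModuleCat.{u} A, Module.Finite A N → Subsingleton (Ext N L (r + 1)))
      → ∀ N : ModuleCat.{u} A, Module.Finite A N → Subsingleton (Ext N L 1) := by
    intro r
    induction r with
    | zero => exact fun h => h
    | succ r ih =>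
      intro h
      refine ih fun N hN => subsingleton_ext_of_residueField L (r + 1) ?_ h N hN
      have hS := ModuleCat.shortComplex_shortExact
        (ModuleCat.shortComplexOfCompEqZero ι (LinearMap.range ι).mkQ
          ι.exact_map_mkQ_range.linearMap_comp_eq_zero) ι.exact_map_mkQ_range hι
          (Submodule.mkQ_surjective _)
      refine subsingleton_of_forall_eq 0 fun z => ?_
      obtain ⟨w, hw⟩ := Ext.contravariant_sequence_exact₁ hS L z (add_comm 1 (r + 1))
        ((h (ModuleCat.of A (A ⧸ LinearMap.range ι)) inferInstance).elim _ _)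
      have : Projective (ModuleCat.of A A) := inferInstance
      have hw0 : w = 0 := Ext.eq_zero_of_projective (P := ModuleCat.of A A) w
      rw [← hw, hw0, Ext.comp_zero]
  have h1 := hone n fun N _ => HasInjectiveDimensionLT.subsingleton L n (n + 1) (by omega) N
  refine ⟨h1, ?_⟩
  -- Without a socle Hom(k, L) = 0, and the descent reaches degree 0: Hom(A, L) = 0, so L = 0.
  by_contra! hsoc
  have hk : Subsingleton (Ext (ModuleCat.of A (A ⧸ maximalIdeal A)) L 0) := by
    refine (Ext.addEquiv₀.trans ModuleCat.homAddEquiv).subsingleton_congr.2 ⟨fun f g => ?_⟩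
    suffices h : ∀ f : (A ⧸ maximalIdeal A) →ₗ[A] L, f = 0 by
      exact (h f).trans (h g).symm
    intro f
    by_contra hf
    have h1 : f 1 ≠ 0 := fun h0 => hf (by
      refine Submodule.linearMap_qext _ (LinearMap.ext_ring ?_)
      simpa using h0)
    obtain ⟨m, hm, hm'⟩ := hsoc _ h1
    refine hm' ?_
    rw [← map_smul]
    convert map_zero f
    rw [Algebra.smul_def, mul_one]
    exact Ideal.Quotient.eq_zero_iff_mem.2 hm
  have h0 := subsingleton_ext_of_residueField L 0 hk h1 A inferInstance
  have h0' := (Ext.addEquiv₀.trans ModuleCat.homAddEquiv).subsingleton_congr.1 h0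
  obtain ⟨l, hl⟩ := exists_ne (0 : L)
  refine hl ?_
  have := LinearMap.congr_fun (h0'.elim (LinearMap.toSpanSingleton A L l) 0) 1
  simpa using this

/-- If `Ext¹(-, L)` vanishes on finite modules, maps from ideals into `L` extend to the ring. -/
theorem exists_extension_of_subsingleton_ext_one {A : Type u} [CommRing A]
    (L : ModuleCat.{u} A)
    (h : ∀ N : ModuleCat.{u} A, Module.Finite A N → Subsingleton (Ext N L 1))
    (I : Ideal A) (f : I →ₗ[A] L) : ∃ l : L, ∀ x : I, f x = (x : A) • l := by
  have hS := ModuleCat.shortComplex_shortExact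
    (ModuleCat.shortComplexOfCompEqZero I.subtype I.mkQ
      (LinearMap.exact_subtype_mkQ I).linearMap_comp_eq_zero) (LinearMap.exact_subtype_mkQ I)
      I.injective_subtype (Submodule.mkQ_surjective _)
  obtain ⟨w, hw⟩ := Ext.contravariant_sequence_exact₁ hS L (Ext.mk₀ (ModuleCat.ofHom f))
    (add_comm 1 0) ((h (ModuleCat.of A (A ⧸ I)) inferInstance).elim _ _)
  obtain ⟨g, rfl⟩ := Ext.homEquiv₀.symm.surjective w
  have hg : ModuleCat.ofHom I.subtype ≫ g = ModuleCat.ofHom f :=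
    Ext.homEquiv₀.symm.injective (by simpa using hw)
  refine ⟨g.hom 1, fun x => ?_⟩
  rw [← map_smul]
  have := ConcreteCategory.congr_hom hg x
  simpa using this.symm

/-! ### Injective dimension modulo a regular element -/

/-- The map induced on `x`-torsion by a linear map, linear over `A ⧸ (x)`. -/
def torsionByMap {A : Type u} [CommRing A] (x : A) {C J : Type u} [AddCommGroup C] [Module A C]
    [AddCommGroup J] [Module A J] (φ : C →ₗ[A] J) :
    Submodule.torsionBy A C x →ₗ[A ⧸ Ideal.span {x}] Submodule.torsionBy A J x :=
  LinearMap.extendScalarsOfSurjective (R := A) Ideal.Quotient.mk_surjective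
    (φ.restrict (p := Submodule.torsionBy A C x) (q := Submodule.torsionBy A J x)
      fun c hc => by
        rw [Submodule.mem_torsionBy_iff] at hc ⊢
        rw [← map_smul, hc, map_zero])

@[simp]
theorem coe_torsionByMap {A : Type u} [CommRing A] (x : A) {C J : Type u} [AddCommGroup C]
    [Module A C] [AddCommGroup J] [Module A J] (φ : C →ₗ[A] J) (c : Submodule.torsionBy A C x) :
    (torsionByMap x φ c : J) = φ c := rfl

/-- The `x`-torsion of an injective module is injective over `A ⧸ (x)`. -/
theorem injective_torsionBy {A : Type u} [CommRing A] (x : A) (J : Type u) [AddCommGroup J]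
    [Module A J] [Module.Injective A J] :
    Module.Injective (A ⧸ Ideal.span {x}) (Submodule.torsionBy A J x) := by
  refine Module.Baer.injective fun I g => ?_
  have hI : Function.Injective (I.subtype.restrictScalars A) := I.injective_subtype
  obtain ⟨h, hh⟩ := Module.Injective.out (R := A) (I.subtype.restrictScalars A) hI
    ((Submodule.torsionBy A J x).subtype ∘ₗ g.restrictScalars A)
  have hx : ∀ b : A ⧸ Ideal.span {x}, h b ∈ Submodule.torsionBy A J x := by
    intro b
    rw [Submodule.mem_torsionBy_iff, ← map_smul]
    convert map_zero h
    rw [Algebra.smul_def, Ideal.Quotient.algebraMap_eq,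
      Ideal.Quotient.eq_zero_iff_mem.2 (Ideal.mem_span_singleton_self x), zero_mul]
  refine ⟨LinearMap.extendScalarsOfSurjective (R := A) Ideal.Quotient.mk_surjective
    (h.codRestrict _ hx), fun b hb => Subtype.ext (hh ⟨b, hb⟩)⟩

/-- Injective modules are divisible by regular elements. -/
theorem Module.Injective.exists_smul_eq {A : Type u} [CommRing A] {x : A}
    (hx : IsSMulRegular A x) (J : Type u) [AddCommGroup J] [Module A J] [Module.Injective A J]
    (c : J) : ∃ c', x • c' = c := by
  obtain ⟨h, hh⟩ := Module.Injective.out (R := A) (LinearMap.mulLeft A x) hx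
    (LinearMap.toSpanSingleton A J c)
  refine ⟨h 1, ?_⟩
  rw [← map_smul]
  simpa using hh 1

/-- For an `x`-divisible module `C` the injective dimension over `A ⧸ (x)` of its `x`-torsion is
at most the injective dimension of `C`. -/
theorem hasInjectiveDimensionLE_torsionBy {A : Type u} [CommRing A] {x : A}
    (hx : IsSMulRegular A x) (s : ℕ) (C : Type u) [AddCommGroup C] [Module A C]
    (hdiv : ∀ c : C, ∃ c', x • c' = c) (hC : HasInjectiveDimensionLE (ModuleCat.of A C) s) :
    HasInjectiveDimensionLE
      (ModuleCat.of (A ⧸ Ideal.span {x}) (Submodule.torsionBy A C x)) s := by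
  induction s generalizing C with
  | zero =>
    have hC' := injective_iff_hasInjectiveDimensionLT_one.2 hC
    have : Module.Injective A C := Module.injective_module_of_injective_object A C
    have := injective_torsionBy x C
    refine injective_iff_hasInjectiveDimensionLT_one.1 ?_
    exact Module.injective_object_of_injective_module _ _
  | succ s ih =>
    -- Dimension shifting: the cokernel D of C → J is again x-divisible, and divisibility of C makes
    -- J[x] → D[x] surjective.
    obtain ⟨J, hJ, ι, hι⟩ := EnoughInjectives.presentation (ModuleCat.of A C)
    have hιi : Function.Injective ι.hom := (ModuleCat.mono_iff_injective ι).1 hι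
    have hJ' : Module.Injective A J := Module.injective_module_of_injective_object A J
    let D := J ⧸ LinearMap.range ι.hom
    let π : J →ₗ[A] D := (LinearMap.range ι.hom).mkQ
    have hπ : Function.Surjective π := Submodule.mkQ_surjective _
    have hex : Function.Exact ι.hom π := ι.hom.exact_map_mkQ_range
    have hS := ModuleCat.shortComplex_shortExact
      (ModuleCat.shortComplexOfCompEqZero ι.hom π hex.linearMap_comp_eq_zero) hex hιi hπ
    have hD : HasInjectiveDimensionLE (ModuleCat.of A D) s :=
      (hS.hasInjectiveDimensionLT_X₃_iff s hJ).2 hC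
    have hDdiv : ∀ d : D, ∃ d', x • d' = d := by
      intro d
      obtain ⟨j, rfl⟩ := hπ d
      obtain ⟨j', rfl⟩ := Module.Injective.exists_smul_eq hx J j
      exact ⟨π j', (map_smul _ _ _).symm⟩
    have hTex : Function.Exact (torsionByMap x ι.hom) (torsionByMap x π) := by
      intro j
      constructor
      · intro hj
        obtain ⟨c, hc⟩ := (hex (j : J)).1 (congrArg Subtype.val hj)
        refine ⟨⟨c, ?_⟩, Subtype.ext hc⟩
        rw [Submodule.mem_torsionBy_iff]
        apply hιi
        rw [map_smul, hc, map_zero]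
        exact j.2
      · rintro ⟨c, rfl⟩
        exact Subtype.ext ((hex _).2 ⟨c, rfl⟩)
    have hTi : Function.Injective (torsionByMap x ι.hom) := fun c c' h =>
      Subtype.ext (hιi (congrArg Subtype.val h))
    have hTs : Function.Surjective (torsionByMap x π) := by
      rintro ⟨d, hd⟩
      obtain ⟨j, rfl⟩ := hπ d
      rw [Submodule.mem_torsionBy_iff, ← map_smul] at hd
      obtain ⟨c, hc⟩ := (hex _).1 hd
      obtain ⟨c', rfl⟩ := hdiv c
      refine ⟨⟨j - ι.hom c', ?_⟩, Subtype.ext ?_⟩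
      · rw [Submodule.mem_torsionBy_iff, smul_sub, ← hc, map_smul, sub_self]
      · rw [coe_torsionByMap, map_sub, (hex _).2 ⟨c', rfl⟩, sub_zero]
    have hT := ModuleCat.shortComplex_shortExact
      (ModuleCat.shortComplexOfCompEqZero _ _ hTex.linearMap_comp_eq_zero) hTex hTi hTs
    have := injective_torsionBy x J
    exact (hT.hasInjectiveDimensionLT_X₃_iff s
      (Module.injective_object_of_injective_module _ _)).1 (ih D hDdiv hD)

/-- If `x` is regular on `A` and on `L`, and `L` has finite injective dimension over `A`, then
`L / xL` has finite injective dimension over `A ⧸ (x)`. -/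
theorem hasInjectiveDimensionLE_quotSMulTop {A : Type u} [CommRing A] {x : A}
    (hx : IsSMulRegular A x) (s : ℕ) (L : Type u) [AddCommGroup L] [Module A L]
    (hxL : IsSMulRegular L x) (hL : HasInjectiveDimensionLE (ModuleCat.of A L) (s + 1)) :
    HasInjectiveDimensionLE (ModuleCat.of (A ⧸ Ideal.span {x}) (QuotSMulTop x L)) s := by
  -- As L[x] = 0 and J = xJ, the snake lemma for multiplication by x on 0 → L → J → D → 0 gives 0 →
  -- J[x] → D[x] → L/xL → 0. The first term is injective and the second has injective dimension at
  -- most s.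
  obtain ⟨J, hJ, ι, hι⟩ := EnoughInjectives.presentation (ModuleCat.of A L)
  have hιi : Function.Injective ι.hom := (ModuleCat.mono_iff_injective ι).1 hι
  have hJ' : Module.Injective A J := Module.injective_module_of_injective_object A J
  let D := J ⧸ LinearMap.range ι.hom
  let π : J →ₗ[A] D := (LinearMap.range ι.hom).mkQ
  have hπ : Function.Surjective π := Submodule.mkQ_surjective _
  have hex : Function.Exact ι.hom π := ι.hom.exact_map_mkQ_range
  have hS := ModuleCat.shortComplex_shortExact
    (ModuleCat.shortComplexOfCompEqZero ι.hom π hex.linearMap_comp_eq_zero) hex hιi hπ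
  have hD : HasInjectiveDimensionLE (ModuleCat.of A D) s :=
    (hS.hasInjectiveDimensionLT_X₃_iff s hJ).2 hL
  have hDdiv : ∀ d : D, ∃ d', x • d' = d := by
    intro d
    obtain ⟨j, rfl⟩ := hπ d
    obtain ⟨j', rfl⟩ := Module.Injective.exists_smul_eq hx J j
    exact ⟨π j', (map_smul _ _ _).symm⟩
  have hT := hasInjectiveDimensionLE_torsionBy hx s D hDdiv hD
  -- the connecting map `D[x] → L / xL`
  have hlift : ∀ d : Submodule.torsionBy A D x, ∃ l : L, ∃ j : J, ι.hom l = x • j ∧ π j = d := by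
    rintro ⟨d, hd⟩
    obtain ⟨j, rfl⟩ := hπ d
    rw [Submodule.mem_torsionBy_iff, ← map_smul] at hd
    obtain ⟨l, hl⟩ := (hex _).1 hd
    exact ⟨l, j, hl, rfl⟩
  choose l j hl hj using hlift
  -- Two choices of (l, j) over one element of D[x] differ by a pair with `π j₁ = 0`; linearity of
  -- the connecting map and its independence of choices both reduce to this case.
  have huniq : ∀ (l₁ : L) (j₁ : J), ι.hom l₁ = x • j₁ → π j₁ = 0 →
      (Submodule.Quotient.mk l₁ : QuotSMulTop x L) = 0 := by
    intro l₁ j₁ h₁ h₂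
    obtain ⟨l₂, rfl⟩ := (hex _).1 h₂
    rw [← map_smul] at h₁
    rw [Submodule.Quotient.mk_eq_zero, hιi h₁]
    exact Submodule.smul_mem_pointwise_smul _ _ _ trivial
  let δ₀ : Submodule.torsionBy A D x →ₗ[A] QuotSMulTop x L :=
    { toFun := fun d => Submodule.Quotient.mk (l d)
      map_add' := fun d d' => by
        rw [← Submodule.Quotient.mk_add, ← sub_eq_zero, ← Submodule.Quotient.mk_sub]
        refine huniq _ (j (d + d') - (j d + j d')) ?_ ?_
        · simp only [map_sub, map_add, hl, smul_sub, smul_add]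
        · simp [hj]
      map_smul' := fun a d => by
        rw [RingHom.id_apply, ← Submodule.Quotient.mk_smul, ← sub_eq_zero,
          ← Submodule.Quotient.mk_sub]
        refine huniq _ (j (a • d) - a • j d) ?_ ?_
        · simp only [map_sub, map_smul, hl, smul_sub, smul_comm a x]
        · simp [hj] }
  have hδ : ∀ d l₁ j₁, ι.hom l₁ = x • j₁ → π j₁ = d.1 →
      δ₀ d = Submodule.Quotient.mk l₁ := by
    intro d l₁ j₁ h₁ h₂
    refine sub_eq_zero.1 ((Submodule.Quotient.mk_sub _).symm.trans ?_)
    refine huniq _ (j d - j₁) ?_ ?_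
    · simp only [map_sub, hl, h₁, smul_sub]
    · simp [hj, h₂]
  let δ := LinearMap.extendScalarsOfSurjective (R := A) (S := A ⧸ Ideal.span {x})
    Ideal.Quotient.mk_surjective δ₀
  have hTi : Function.Injective (torsionByMap x π) := by
    rw [injective_iff_map_eq_zero]
    intro c hc
    obtain ⟨l₁, hl₁⟩ : ∃ l₁, ι.hom l₁ = (c : J) := (hex _).1 (congrArg Subtype.val hc)
    have hc2 := c.2
    rw [Submodule.mem_torsionBy_iff, ← hl₁, ← map_smul] at hc2
    have : l₁ = 0 := hxL.right_eq_zero_of_smul (hιi (hc2.trans (map_zero _).symm))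
    refine Subtype.ext ?_
    rw [← hl₁, this, map_zero]
    rfl
  have hTs : Function.Surjective δ := by
    intro q
    obtain ⟨l₁, rfl⟩ := Submodule.Quotient.mk_surjective _ q
    obtain ⟨j₁, hj₁⟩ := Module.Injective.exists_smul_eq hx J (ι.hom l₁)
    refine ⟨⟨π j₁, ?_⟩, hδ _ l₁ j₁ hj₁.symm rfl⟩
    rw [Submodule.mem_torsionBy_iff, ← map_smul, hj₁]
    exact (hex _).2 ⟨l₁, rfl⟩
  have hTex : Function.Exact (torsionByMap x π) δ := by
    intro d
    constructor
    · intro hd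
      change (Submodule.Quotient.mk (l d) : QuotSMulTop x L) = 0 at hd
      rw [Submodule.Quotient.mk_eq_zero, Submodule.mem_smul_pointwise_iff_exists] at hd
      obtain ⟨l₁, -, hl₁⟩ := hd
      refine ⟨⟨j d - ι.hom l₁, ?_⟩, Subtype.ext ?_⟩
      · rw [Submodule.mem_torsionBy_iff, smul_sub, ← hl, ← map_smul, hl₁, sub_self]
      · rw [coe_torsionByMap, map_sub, (hex _).2 ⟨l₁, rfl⟩, sub_zero, hj]
    · rintro ⟨c, rfl⟩
      refine (hδ _ 0 c.1 ?_ rfl).trans rfl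
      rw [map_zero]
      exact c.2.symm
  have hE := ModuleCat.shortComplex_shortExact
    (ModuleCat.shortComplexOfCompEqZero _ _ hTex.linearMap_comp_eq_zero) hTex hTi hTs
  have := injective_torsionBy x J
  have hI : Injective (ModuleCat.of (A ⧸ Ideal.span {x}) (Submodule.torsionBy A J x)) :=
    Module.injective_object_of_injective_module _ _
  have hI' : HasInjectiveDimensionLT
      (ModuleCat.of (A ⧸ Ideal.span {x}) (Submodule.torsionBy A J x)) (s + 2) :=
    hasInjectiveDimensionLT_of_ge _ 1 _ (by omega)
  exact hE.hasInjectiveDimensionLT_X₃ (s + 1) hT hI'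

/-! ### Iterated minimal syzygies -/

/-- Iterated syzygies of vector spaces over the residue field, formed with minimal free covers. -/
def IsIteratedSyzygy (A : Type u) [CommRing A] [IsLocalRing A] : ℕ → ModuleCat.{u} A → Prop
  | 0, M => Module.Finite A M ∧ ∀ a ∈ maximalIdeal A, ∀ y : M, a • y = 0
  | n + 1, M => ∃ (b : ℕ) (N : ModuleCat.{u} A) (f : M →ₗ[A] (Fin b → A))
      (g : (Fin b → A) →ₗ[A] N), Function.Injective f ∧ Function.Exact f g ∧
        Function.Surjective g ∧ (∀ y i, f y i ∈ maximalIdeal A) ∧ IsIteratedSyzygy A n N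

theorem IsIteratedSyzygy.finite {A : Type u} [CommRing A] [IsLocalRing A] [IsNoetherianRing A]
    {n : ℕ} {M : ModuleCat.{u} A} (h : IsIteratedSyzygy A n M) : Module.Finite A M := by
  cases n with
  | zero => exact h.1
  | succ n =>
    obtain ⟨b, N, f, g, hf, -⟩ := h
    exact Module.Finite.of_injective f hf

theorem mem_smul_top_of_forall_mem {A : Type u} [CommRing A] (I : Ideal A) {b : ℕ}
    {v : Fin b → A} (hv : ∀ i, v i ∈ I) : v ∈ I • (⊤ : Submodule A (Fin b → A)) := by
  rw [pi_eq_sum_univ' v]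
  exact Submodule.sum_mem _ fun i _ => Submodule.smul_mem_smul (hv i) trivial

/-- Nakayama: every element of F₂ agrees with one of the range of φ modulo ker h, hence modulo 𝔪F₂.
-/
theorem surjective_of_ker_le_smul {A : Type u} [CommRing A] [IsLocalRing A]
    {F₁ F₂ N : Type u} [AddCommGroup F₁] [Module A F₁] [AddCommGroup F₂] [Module A F₂]
    [AddCommGroup N] [Module A N] [Module.Finite A F₂] (φ : F₁ →ₗ[A] F₂) (h : F₂ →ₗ[A] N)
    (hs : Function.Surjective (h ∘ₗ φ))
    (hk : LinearMap.ker h ≤ maximalIdeal A • (⊤ : Submodule A F₂)) : Function.Surjective φ := by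
  rw [← LinearMap.range_eq_top, ← top_le_iff]
  refine Submodule.le_of_le_smul_of_le_jacobson_bot (I := maximalIdeal A) Module.Finite.fg_top
    (IsLocalRing.maximalIdeal_le_jacobson _) ?_
  intro y _
  obtain ⟨z, hz⟩ := hs (h y)
  rw [← add_sub_cancel (φ z) y]
  refine Submodule.add_mem_sup ⟨z, rfl⟩ (hk ?_)
  rw [LinearMap.mem_ker, map_sub, ← hz, LinearMap.comp_apply, sub_self]

/-- Minimal free covers are unique up to isomorphism. -/
theorem exists_equiv_of_minimal_covers {A : Type u} [CommRing A] [IsLocalRing A]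
    {F₁ F₂ N : Type u} [AddCommGroup F₁] [Module A F₁] [AddCommGroup F₂] [Module A F₂]
    [AddCommGroup N] [Module A N] [Module.Finite A F₁] [Module.Finite A F₂]
    [Module.Projective A F₁] [Module.Projective A F₂] (h₁ : F₁ →ₗ[A] N) (h₂ : F₂ →ₗ[A] N)
    (hs₁ : Function.Surjective h₁) (hs₂ : Function.Surjective h₂)
    (hk₁ : LinearMap.ker h₁ ≤ maximalIdeal A • (⊤ : Submodule A F₁))
    (hk₂ : LinearMap.ker h₂ ≤ maximalIdeal A • (⊤ : Submodule A F₂)) :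
    ∃ e : F₁ ≃ₗ[A] F₂, ∀ y, h₂ (e y) = h₁ y := by
  obtain ⟨φ, hφ⟩ := Module.projective_lifting_property h₂ h₁ hs₂
  obtain ⟨ψ, hψ⟩ := Module.projective_lifting_property h₁ h₂ hs₁
  have hφs := surjective_of_ker_le_smul φ h₂ (hφ ▸ hs₁) hk₂
  have hψs := surjective_of_ker_le_smul ψ h₁ (hψ ▸ hs₂) hk₁
  have hinj : Function.Injective (ψ ∘ₗ φ) :=
    OrzechProperty.injective_of_surjective_endomorphism (ψ ∘ₗ φ) (hψs.comp hφs)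
  exact ⟨LinearEquiv.ofBijective φ ⟨Function.Injective.of_comp hinj, hφs⟩,
    fun y => LinearMap.congr_fun hφ y⟩

/-- The minimal syzygy of a product is a product of minimal syzygies. -/
theorem exists_prod_syzygy {A : Type u} [CommRing A] [IsLocalRing A] [IsNoetherianRing A]
    {M : Type u} [AddCommGroup M] [Module A M] {P Q : ModuleCat.{u} A} {b n k : ℕ}
    (f : M →ₗ[A] (Fin b → A)) (g : (Fin b → A) →ₗ[A] P × Q) (hf : Function.Injective f)
    (hfg : Function.Exact f g) (hg : Function.Surjective g)
    (hmin : ∀ y i, f y i ∈ maximalIdeal A) (hP : IsIteratedSyzygy A n P)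
    (hQ : IsIteratedSyzygy A k Q) :
    ∃ P' Q' : ModuleCat.{u} A, IsIteratedSyzygy A (n + 1) P' ∧ IsIteratedSyzygy A (k + 1) Q' ∧
      Nonempty (M ≃ₗ[A] P' × Q') := by
  have := hP.finite
  have := hQ.finite
  obtain ⟨c, h, hh, hh'⟩ := exists_minimal_free_cover A P
  obtain ⟨c', h', hh₂, hh₂'⟩ := exists_minimal_free_cover A Q
  -- Both g and the product of minimal covers of P and Q are minimal covers of P × Q, so their
  -- kernels M and ker h × ker h' correspond.
  obtain ⟨e, he⟩ := exists_equiv_of_minimal_covers g (h.prodMap h') hg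
    (Function.Surjective.prodMap hh hh₂)
    (by
      intro v hv
      obtain ⟨y, rfl⟩ := (hfg v).1 hv
      exact mem_smul_top_of_forall_mem _ (hmin y))
    (by
      rintro ⟨v, w⟩ hvw
      rw [LinearMap.mem_ker, LinearMap.prodMap_apply, Prod.mk_eq_zero] at hvw
      have h1 := Submodule.smul_top_le_comap_smul_top (maximalIdeal A)
        (LinearMap.inl A (Fin c → A) (Fin c' → A))
        (mem_smul_top_of_forall_mem _ (hh' v hvw.1))
      have h2 := Submodule.smul_top_le_comap_smul_top (maximalIdeal A)
        (LinearMap.inr A (Fin c → A) (Fin c' → A))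
        (mem_smul_top_of_forall_mem _ (hh₂' w hvw.2))
      simpa using add_mem (Submodule.mem_comap.1 h1) (Submodule.mem_comap.1 h2))
  have hker : ∀ y, h (e (f y)).1 = 0 ∧ h' (e (f y)).2 = 0 := fun y =>
    Prod.mk_eq_zero.1 ((he (f y)).trans ((hfg _).2 ⟨y, rfl⟩))
  let θ : M →ₗ[A] LinearMap.ker h × LinearMap.ker h' :=
    ((LinearMap.fst A _ _ ∘ₗ e.toLinearMap ∘ₗ f).codRestrict _ fun y => (hker y).1).prod
      ((LinearMap.snd A _ _ ∘ₗ e.toLinearMap ∘ₗ f).codRestrict _ fun y => (hker y).2)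
  refine ⟨ModuleCat.of A (LinearMap.ker h), ModuleCat.of A (LinearMap.ker h'),
    ⟨c, P, (LinearMap.ker h).subtype, h, Subtype.val_injective,
      LinearMap.exact_subtype_ker_map h, hh, fun y => hh' _ y.2, hP⟩,
    ⟨c', Q, (LinearMap.ker h').subtype, h', Subtype.val_injective,
      LinearMap.exact_subtype_ker_map h', hh₂, fun y => hh₂' _ y.2, hQ⟩,
    ⟨LinearEquiv.ofBijective θ ⟨?_, ?_⟩⟩⟩
  · intro y z hyz
    refine hf (e.injective (Prod.ext ?_ ?_))
    · exact congrArg (fun t => t.1.1) hyz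
    · exact congrArg (fun t => t.2.1) hyz
  · rintro ⟨⟨v, hv⟩, ⟨w, hw⟩⟩
    obtain ⟨y, hy⟩ := (hfg (e.symm (v, w))).1 (by
      rw [← he, LinearEquiv.apply_symm_apply]
      exact Prod.ext hv hw)
    have hy' : e (f y) = (v, w) := by rw [hy, LinearEquiv.apply_symm_apply]
    exact ⟨y, Prod.ext (Subtype.ext (congrArg Prod.fst hy'))
      (Subtype.ext (congrArg Prod.snd hy'))⟩

/-! ### Reduction of syzygies modulo x -/

/-- A submodule meeting `𝔪M` trivially is a direct summand. -/
theorem exists_isCompl_of_inf_smul_eq_bot {A : Type u} [CommRing A] [IsLocalRing A]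
    {M : Type u} [AddCommGroup M] [Module A M] (K : Submodule A M)
    (hK : K ⊓ maximalIdeal A • (⊤ : Submodule A M) = ⊥) : ∃ S : Submodule A M, IsCompl K S := by
  let : Field (A ⧸ maximalIdeal A) := Ideal.Quotient.field _
  let π := (maximalIdeal A • (⊤ : Submodule A M)).mkQ
  have : IsSemisimpleModule A (M ⧸ maximalIdeal A • (⊤ : Submodule A M)) := by
    -- The identity, semilinear along A → A/𝔪, carries semisimplicity over the residue field back to
    -- A.
    let σ : (M ⧸ maximalIdeal A • (⊤ : Submodule A M)) →ₛₗ[Ideal.Quotient.mk (maximalIdeal A)]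
        (M ⧸ maximalIdeal A • (⊤ : Submodule A M)) :=
      { toFun := id, map_add' := fun _ _ => rfl, map_smul' := fun _ _ => rfl }
    exact (σ.isSemisimpleModule_iff_of_bijective Function.bijective_id).2 inferInstance
  obtain ⟨W, hW⟩ := exists_isCompl (K.map π)
  refine ⟨W.comap π, ?_, ?_⟩
  · rw [Submodule.disjoint_def]
    intro y hy hy'
    have h0 : π y = 0 := Submodule.disjoint_def.1 hW.disjoint _ ⟨y, hy, rfl⟩ hy'
    have h1 : y ∈ K ⊓ maximalIdeal A • (⊤ : Submodule A M) :=
      ⟨hy, (Submodule.Quotient.mk_eq_zero _).1 h0⟩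
    rwa [hK] at h1
  · rw [codisjoint_iff, eq_top_iff]
    intro y _
    have hy : π y ∈ K.map π ⊔ W := hW.codisjoint.eq_top ▸ trivial
    obtain ⟨_, ⟨k, hk, rfl⟩, w, hw, hkw⟩ := Submodule.mem_sup.1 hy
    refine Submodule.mem_sup.2 ⟨k, hk, y - k, ?_, add_sub_cancel _ _⟩
    rw [Submodule.mem_comap, map_sub, ← hkw, add_sub_cancel_left]
    exact hw

/-- A linear map into a module over a quotient ring descends along a surjection. -/
theorem exists_descent {A B M M' T : Type u} [CommRing A] [CommRing B] [Algebra A B]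
    [AddCommGroup M] [Module A M] [AddCommGroup M'] [Module A M'] [Module B M']
    [IsScalarTower A B M'] [AddCommGroup T] [Module A T] [Module B T] [IsScalarTower A B T]
    (hB : Function.Surjective (algebraMap A B)) (p : M →ₗ[A] M') (hp : Function.Surjective p)
    (φ : M →ₗ[A] T) (h : ∀ y, p y = 0 → φ y = 0) :
    ∃ φ' : M' →ₗ[B] T, ∀ y, φ' (p y) = φ y := by
  refine ⟨LinearMap.extendScalarsOfSurjective (R := A) hB
    ((LinearMap.ker p).liftQ φ h ∘ₗ (p.quotKerEquivOfSurjective hp).symm.toLinearMap), fun y => ?_⟩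
  change (LinearMap.ker p).liftQ φ h ((p.quotKerEquivOfSurjective hp).symm (p y)) = φ y
  have : (p.quotKerEquivOfSurjective hp).symm (p y) = Submodule.Quotient.mk y := by
    rw [LinearEquiv.symm_apply_eq]; rfl
  rw [this]; rfl

/-- Coordinatewise reduction of free modules. -/
def piReduction (A B : Type u) [CommRing A] [CommRing B] [Algebra A B] (b : ℕ) :
    (Fin b → A) →ₗ[A] (Fin b → B) :=
  (Algebra.linearMap A B).compLeft (Fin b)

@[simp]
theorem piReduction_apply {A B : Type u} [CommRing A] [CommRing B] [Algebra A B] {b : ℕ}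
    (v : Fin b → A) (i : Fin b) : piReduction A B b v i = algebraMap A B (v i) := rfl

theorem piReduction_surjective {A B : Type u} [CommRing A] [CommRing B] [Algebra A B]
    (hB : Function.Surjective (algebraMap A B)) (b : ℕ) :
    Function.Surjective (piReduction A B b) := by
  intro w
  choose v hv using fun i => hB (w i)
  exact ⟨v, funext hv⟩

theorem piReduction_eq_zero_iff {A B : Type u} [CommRing A] [CommRing B] [Algebra A B] {x : A}
    (hx : ∀ a, algebraMap A B a = 0 ↔ ∃ c, a = x * c) {b : ℕ} (v : Fin b → A) :
    piReduction A B b v = 0 ↔ ∃ w, v = x • w := by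
  constructor
  · intro h
    choose w hw using fun i => (hx (v i)).1 (congrFun h i)
    exact ⟨w, funext hw⟩
  · rintro ⟨w, rfl⟩
    exact funext fun i => (hx _).2 ⟨w i, rfl⟩

/-- The reduction of `𝔪A^b` modulo `x ∈ 𝔪 \ 𝔪²` splits as `𝔪B^b` and a vector space. -/
theorem exists_splitting_first_syzygy {A B : Type u} [CommRing A] [IsLocalRing A]
    [IsNoetherianRing A] [CommRing B] [IsLocalRing B] [Algebra A B] {x : A}
    (hB : Function.Surjective (algebraMap A B))
    (hker : ∀ a, algebraMap A B a = 0 ↔ ∃ c, a = x * c)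
    (hmem : ∀ a, algebraMap A B a ∈ maximalIdeal B ↔ a ∈ maximalIdeal A)
    (hx2 : x ∉ maximalIdeal A ^ 2)
    {M : ModuleCat.{u} A} (hM : IsIteratedSyzygy A 1 M)
    (M' : Type u) [AddCommGroup M'] [Module A M'] [Module B M'] [IsScalarTower A B M']
    (p : M →ₗ[A] M') (hp : Function.Surjective p) (hpx : ∀ y, p y = 0 ↔ ∃ z, y = x • z) :
    ∃ P Q : ModuleCat.{u} B, IsIteratedSyzygy B 1 P ∧ IsIteratedSyzygy B 0 Q ∧
      Nonempty (M' ≃ₗ[B] P × Q) := by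
  have hMf := hM.finite
  have : IsNoetherianRing B := isNoetherianRing_of_surjective A B _ hB
  have : Module.Finite A M' := Module.Finite.of_surjective p hp
  have : Module.Finite B M' := Module.Finite.of_restrictScalars_finite A B M'
  obtain ⟨b, N, f, g, hf, hfg, hg, hmin, -, hN⟩ := hM
  -- N is killed by 𝔪, so the image of f is all of 𝔪A^b.
  have hgm : ∀ v : Fin b → A, (∀ i, v i ∈ maximalIdeal A) → ∃ y, f y = v := by
    intro v hv
    refine (hfg v).1 ?_
    have := mem_smul_top_of_forall_mem _ hv
    refine Submodule.smul_induction_on this (fun a ha w _ => ?_) fun u w hu hw => ?_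
    · rw [map_smul, hN a ha]
    · rw [map_add, hu, hw, add_zero]
  obtain ⟨f', hf'⟩ := exists_descent hB p hp (piReduction A B b ∘ₗ f) (by
    intro y hy
    obtain ⟨z, rfl⟩ := (hpx y).1 hy
    exact (piReduction_eq_zero_iff hker _).2 ⟨f z, map_smul _ _ _⟩)
  simp only [LinearMap.comp_apply] at hf'
  have hrange : ∀ y' i, f' y' i ∈ maximalIdeal B := by
    intro y' i
    obtain ⟨y, rfl⟩ := hp y'
    rw [hf', piReduction_apply, hmem]
    exact hmin y i
  have hrange' : ∀ v : Fin b → B, (∀ i, v i ∈ maximalIdeal B) → ∃ y', f' y' = v := by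
    intro v hv
    obtain ⟨w, rfl⟩ := piReduction_surjective hB b v
    obtain ⟨y, rfl⟩ := hgm w fun i => (hmem _).1 (hv i)
    exact ⟨p y, hf' y⟩
  -- The kernel of f' is xA^b / x𝔪A^b, a vector space.
  have hKm : ∀ c ∈ maximalIdeal B, ∀ z ∈ LinearMap.ker f', c • z = 0 := by
    intro c hc z hz
    obtain ⟨a, rfl⟩ := hB c
    obtain ⟨y, rfl⟩ := hp z
    rw [LinearMap.mem_ker, hf'] at hz
    obtain ⟨w, hw⟩ := (piReduction_eq_zero_iff hker _).1 hz
    rw [algebraMap_smul, ← map_smul, hpx]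
    obtain ⟨y', hy'⟩ := hgm (a • w) fun i =>
      Ideal.mul_mem_right (w i) _ ((hmem a).1 hc)
    refine ⟨y', hf ?_⟩
    rw [map_smul, hw, map_smul, hy', smul_comm]
  have hlift : ∀ z ∈ maximalIdeal B • (⊤ : Submodule B M'),
      ∃ y ∈ maximalIdeal A • (⊤ : Submodule A M), p y = z := by
    intro z hz
    refine Submodule.smul_induction_on hz (fun c hc w _ => ?_) fun u w hu hw => ?_
    · obtain ⟨a, rfl⟩ := hB c
      obtain ⟨y, rfl⟩ := hp w
      exact ⟨a • y, Submodule.smul_mem_smul ((hmem a).1 hc) trivial, by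
        rw [map_smul, algebraMap_smul]⟩
    · obtain ⟨y, hy, rfl⟩ := hu
      obtain ⟨y', hy', rfl⟩ := hw
      exact ⟨y + y', add_mem hy hy', map_add _ _ _⟩
  have hsq : ∀ y ∈ maximalIdeal A • (⊤ : Submodule A M), ∀ i, f y i ∈ maximalIdeal A ^ 2 := by
    intro y hy i
    refine Submodule.smul_induction_on hy (fun c hc w _ => ?_) fun u w hu hw => ?_
    · rw [map_smul, pow_two]
      exact Ideal.mul_mem_mul hc (hmin w i)
    · rw [map_add]
      exact add_mem hu hw
  -- Here x ∉ 𝔪² enters: if y ∈ 𝔪M and f y = x w, then every x wᵢ lies in 𝔪², so no wᵢ is a unit.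
  -- Thus w lifts to M and y ∈ xM.
  have hinf : LinearMap.ker f' ⊓ maximalIdeal B • (⊤ : Submodule B M') = ⊥ := by
    rw [eq_bot_iff]
    rintro z ⟨hz, hzm⟩
    obtain ⟨y, hy, rfl⟩ := hlift z hzm
    have hz' := LinearMap.mem_ker.1 hz
    rw [hf'] at hz'
    obtain ⟨w, hw⟩ := (piReduction_eq_zero_iff hker _).1 hz'
    obtain ⟨y', hy'⟩ := hgm w fun i => by
      by_contra hi
      obtain ⟨u, hu⟩ := IsLocalRing.notMem_maximalIdeal.1 hi
      refine hx2 ?_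
      have hxi : x * w i ∈ maximalIdeal A ^ 2 := by
        have := hsq y hy i
        rwa [hw] at this
      rw [← hu] at hxi
      exact (Ideal.mul_unit_mem_iff_mem _ u.isUnit).1 hxi
    rw [Submodule.mem_bot, hpx]
    exact ⟨y', hf (by rw [hw, map_smul, hy'])⟩
  obtain ⟨S, hS⟩ := exists_isCompl_of_inf_smul_eq_bot _ hinf
  let h := f' ∘ₗ S.subtype
  have hhr : ∀ y', ∃ s, h s = f' y' := by
    intro y'
    obtain ⟨k, hk, s, hs, rfl⟩ := Submodule.mem_sup.1
      (hS.codisjoint.eq_top ▸ trivial : y' ∈ LinearMap.ker f' ⊔ S)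
    refine ⟨⟨s, hs⟩, ?_⟩
    rw [map_add, LinearMap.mem_ker.1 hk, zero_add]
    rfl
  refine ⟨ModuleCat.of B S, ModuleCat.of B (LinearMap.ker f'),
    ⟨b, ModuleCat.of B ((Fin b → B) ⧸ LinearMap.range h), h, (LinearMap.range h).mkQ, ?_,
      h.exact_map_mkQ_range, Submodule.mkQ_surjective _, fun y i => hrange _ i,
      inferInstanceAs (Module.Finite B ((Fin b → B) ⧸ LinearMap.range h)), ?_⟩,
    ⟨inferInstanceAs (Module.Finite B (LinearMap.ker f')), fun c hc z =>
      Subtype.ext (hKm c hc z z.2)⟩,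
    ⟨(Submodule.prodEquivOfIsCompl _ _ hS.symm).symm⟩⟩
  · rw [injective_iff_map_eq_zero]
    intro s hs
    exact Subtype.ext (Submodule.disjoint_def.1 hS.disjoint _ hs s.2)
  · intro c hc y
    obtain ⟨v, rfl⟩ := Submodule.mkQ_surjective _ y
    rw [← map_smul]
    refine (Submodule.Quotient.mk_eq_zero _).2 ?_
    obtain ⟨y', hy'⟩ := hrange' (c • v) fun i => Ideal.mul_mem_right _ _ hc
    obtain ⟨s, hs⟩ := hhr y'
    exact ⟨s, hs.trans hy'⟩

/-- Reduction of an iterated syzygy modulo a regular element of `𝔪 \ 𝔪²` is a product of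
iterated syzygies. -/
theorem IsIteratedSyzygy.exists_prod_reduction {A B : Type u} [CommRing A] [IsLocalRing A]
    [IsNoetherianRing A] [CommRing B] [IsLocalRing B] [Algebra A B] {x : A}
    (hB : Function.Surjective (algebraMap A B))
    (hker : ∀ a, algebraMap A B a = 0 ↔ ∃ c, a = x * c)
    (hmem : ∀ a, algebraMap A B a ∈ maximalIdeal B ↔ a ∈ maximalIdeal A)
    (hx : IsSMulRegular A x) (hx2 : x ∉ maximalIdeal A ^ 2) (n : ℕ)
    {M : ModuleCat.{u} A} (hM : IsIteratedSyzygy A n M)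
    (M' : Type u) [AddCommGroup M'] [Module A M'] [Module B M'] [IsScalarTower A B M']
    (p : M →ₗ[A] M') (hp : Function.Surjective p) (hpx : ∀ y, p y = 0 ↔ ∃ z, y = x • z) :
    ∃ (k : ℕ) (P Q : ModuleCat.{u} B), IsIteratedSyzygy B n P ∧ IsIteratedSyzygy B k Q ∧
      Nonempty (M' ≃ₗ[B] P × Q) := by
  have hNoeth : IsNoetherianRing B := isNoetherianRing_of_surjective A B _ hB
  induction n generalizing M M' with
  | zero =>
    obtain ⟨hfin, hM⟩ := hM
    have : Module.Finite A M' := Module.Finite.of_surjective p hp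
    refine ⟨0, ModuleCat.of B M', ModuleCat.of B PUnit.{u + 1},
      ⟨Module.Finite.of_restrictScalars_finite A B M', ?_⟩,
      ⟨inferInstanceAs (Module.Finite B PUnit.{u + 1}), fun _ _ _ => rfl⟩,
      ⟨(LinearEquiv.prodUnique (R := B) (M := M') (M₂ := PUnit.{u + 1})).symm⟩⟩
    intro c hc y
    obtain ⟨a, rfl⟩ := hB c
    obtain ⟨y, rfl⟩ := hp y
    refine (algebraMap_smul B a (p y)).trans ?_
    rw [← map_smul, hM a ((hmem a).1 hc), map_zero]
  | succ n ih =>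
    cases n with
    | zero =>
      obtain ⟨P, Q, h⟩ := exists_splitting_first_syzygy hB hker hmem hx2 hM M' p hp hpx
      exact ⟨0, P, Q, h⟩
    | succ n =>
      obtain ⟨b, N, f, g, hf, hfg, hg, hmin, hN⟩ := hM
      -- N is itself at least a first syzygy, so it embeds in a free module. Regularity of x on N
      -- keeps 0 → M → A^b → N → 0 exact modulo x.
      have hNx : IsSMulRegular N x := by
        obtain ⟨b', N', ι, -, hι, -⟩ := hN
        refine IsSMulRegular.of_right_eq_zero_of_smul fun y hy => hι ?_
        rw [map_zero]
        refine funext fun i => hx.right_eq_zero_of_smul ?_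
        exact congrFun ((map_smul ι x y).symm.trans (by rw [hy, map_zero])) i
      obtain ⟨f', hf'⟩ := exists_descent hB p hp (piReduction A B b ∘ₗ f) (by
        intro y hy
        obtain ⟨z, rfl⟩ := (hpx y).1 hy
        exact (piReduction_eq_zero_iff hker _).2 ⟨f z, map_smul _ _ _⟩)
      simp only [LinearMap.comp_apply] at hf'
      let N' := (Fin b → B) ⧸ LinearMap.range f'
      let π : (Fin b → B) →ₗ[B] N' := (LinearMap.range f').mkQ
      -- This identifies the cokernel N' of f' with N/xN, to which the induction hypothesis applies.
      have hgπ : ∀ v : Fin b → A, π (piReduction A B b v) = 0 ↔ ∃ z, g v = x • z := by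
        intro v
        refine (Submodule.Quotient.mk_eq_zero _).trans ⟨?_, ?_⟩
        · rintro ⟨y', hy'⟩
          obtain ⟨y, rfl⟩ := hp y'
          rw [hf', ← sub_eq_zero, ← map_sub, piReduction_eq_zero_iff hker] at hy'
          obtain ⟨w, hw⟩ := hy'
          refine ⟨-g w, ?_⟩
          rw [smul_neg, ← map_smul, ← hw, map_sub, (hfg _).2 ⟨y, rfl⟩, zero_sub, neg_neg]
        · rintro ⟨z, hz⟩
          obtain ⟨w, rfl⟩ := hg z
          rw [← map_smul, ← sub_eq_zero, ← map_sub] at hz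
          obtain ⟨y, hy⟩ := (hfg _).1 hz
          refine ⟨p y, ?_⟩
          rw [hf', hy, map_sub, (piReduction_eq_zero_iff hker (x • w)).2 ⟨w, rfl⟩, sub_zero]
      obtain ⟨q, hq⟩ := exists_descent (B := A) (M' := N) Function.surjective_id g hg
        (π.restrictScalars A ∘ₗ piReduction A B b) (fun v hv =>
          (hgπ v).2 ⟨0, by rw [hv, smul_zero]⟩)
      simp only [LinearMap.comp_apply, LinearMap.restrictScalars_apply] at hq
      obtain ⟨k, P, Q, hP, hQ, ⟨e⟩⟩ := ih hN N' q
        (by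
          intro y
          obtain ⟨w, rfl⟩ := Submodule.mkQ_surjective _ y
          obtain ⟨v, rfl⟩ := piReduction_surjective hB b w
          exact ⟨g v, hq v⟩)
        (by
          intro y
          obtain ⟨v, rfl⟩ := hg y
          rw [hq, hgπ])
      have hf'i : Function.Injective f' := by
        rw [injective_iff_map_eq_zero]
        intro y' hy'
        obtain ⟨y, rfl⟩ := hp y'
        rw [hf', piReduction_eq_zero_iff hker] at hy'
        obtain ⟨w, hw⟩ := hy'
        have hgw : g w = 0 := hNx.right_eq_zero_of_smul (by
          rw [← map_smul, ← hw]
          exact (hfg _).2 ⟨y, rfl⟩)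
        obtain ⟨z, rfl⟩ := (hfg w).1 hgw
        exact (hpx y).2 ⟨z, hf (by rw [hw, map_smul])⟩
      obtain ⟨P', Q', hP', hQ', hM'⟩ := exists_prod_syzygy f' (e.toLinearMap ∘ₗ π) hf'i
        (by
          intro v
          refine Iff.trans ?_ (f'.exact_map_mkQ_range v)
          exact e.map_eq_zero_iff)
        (e.surjective.comp (Submodule.mkQ_surjective _))
        (by
          intro y' i
          obtain ⟨y, rfl⟩ := hp y'
          rw [hf', piReduction_apply, hmem]
          exact hmin y i) hP hQ
      exact ⟨k + 1, P', Q', hP', hQ', hM'⟩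

/-! ### Modules generated by images of syzygies -/

theorem IsIteratedSyzygy.smul_eq_zero {A : Type u} [CommRing A] [IsLocalRing A] {n : ℕ}
    {M : ModuleCat.{u} A} (hM : IsIteratedSyzygy A n M) {a : A} (ha : a ∈ maximalIdeal A)
    (hma : ∀ y ∈ maximalIdeal A, y * a = 0) (z : M) : a • z = 0 := by
  cases n with
  | zero => exact hM.2 a ha z
  | succ n =>
    obtain ⟨b, N, f, g, hf, -, -, hmin, -⟩ := hM
    refine hf ?_
    rw [map_smul, map_zero]
    refine funext fun i => ?_
    rw [Pi.smul_apply, smul_eq_mul, mul_comm, hma _ (hmin z i), Pi.zero_apply]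

/-- A module is spanned by syzygies when the images of all maps from iterated syzygies
generate it. -/
def IsSpannedBySyzygies (A : Type u) [CommRing A] [IsLocalRing A] (L : Type u) [AddCommGroup L]
    [Module A L] : Prop :=
  ∀ W : Submodule A L, (∀ (n : ℕ) (S : ModuleCat.{u} A), IsIteratedSyzygy A n S →
    ∀ (f : S →ₗ[A] L) (s : S), f s ∈ W) → W = ⊤

/-- A map S → L reduces to S/xS → L/xL, and S/xS is a product of two syzygies over A/(x), whose
images together span the image of S/xS. -/
theorem IsSpannedBySyzygies.quotSMulTop {A : Type u} [CommRing A] [IsLocalRing A]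
    [IsNoetherianRing A] {x : A} [IsLocalRing (A ⧸ Ideal.span {x})]
    (hmem : ∀ a, algebraMap A (A ⧸ Ideal.span {x}) a ∈ maximalIdeal (A ⧸ Ideal.span {x}) ↔
      a ∈ maximalIdeal A)
    (hx : IsSMulRegular A x) (hx2 : x ∉ maximalIdeal A ^ 2)
    (L : Type u) [AddCommGroup L] [Module A L] (hL : IsSpannedBySyzygies A L) :
    IsSpannedBySyzygies (A ⧸ Ideal.span {x}) (QuotSMulTop x L) := by
  intro W hW
  have hB : Function.Surjective (algebraMap A (A ⧸ Ideal.span {x})) := Ideal.Quotient.mk_surjective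
  have hmk : ∀ {T : Type u} [AddCommGroup T] [Module A T] (y : T),
      (x • (⊤ : Submodule A T)).mkQ y = 0 ↔ ∃ z, y = x • z := by
    intro T _ _ y
    rw [Submodule.mkQ_apply, Submodule.Quotient.mk_eq_zero, Submodule.mem_smul_pointwise_iff_exists]
    simp [eq_comm]
  have htop : (W.restrictScalars A).comap (x • (⊤ : Submodule A L)).mkQ = ⊤ := by
    refine hL _ fun n S hS f s => ?_
    obtain ⟨k, P, Q, hP, hQ, ⟨e⟩⟩ := hS.exists_prod_reduction hB
      (fun a => Ideal.Quotient.eq_zero_iff_mem.trans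
        (Ideal.mem_span_singleton.trans Iff.rfl)) hmem hx hx2 n
      (QuotSMulTop x S) (x • (⊤ : Submodule A S)).mkQ (Submodule.mkQ_surjective _) hmk
    obtain ⟨f', hf'⟩ := exists_descent (T := QuotSMulTop x L) hB (x • (⊤ : Submodule A S)).mkQ
      (Submodule.mkQ_surjective _)
      ((x • (⊤ : Submodule A L)).mkQ ∘ₗ f) (fun y hy => by
        obtain ⟨z, rfl⟩ := (hmk y).1 hy
        exact (hmk _).2 ⟨f z, map_smul _ _ _⟩)
    change (x • (⊤ : Submodule A L)).mkQ (f s) ∈ W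
    have h1 := hf' s
    rw [LinearMap.comp_apply] at h1
    rw [← h1]
    generalize (x • (⊤ : Submodule A S)).mkQ s = t
    obtain ⟨⟨p, q⟩, rfl⟩ := e.symm.surjective t
    have hp := hW n P hP (f' ∘ₗ e.symm.toLinearMap ∘ₗ LinearMap.inl _ P Q) p
    have hq := hW k Q hQ (f' ∘ₗ e.symm.toLinearMap ∘ₗ LinearMap.inr _ P Q) q
    have := add_mem hp hq
    simp only [LinearMap.comp_apply, ← map_add] at this
    simpa using this
  rw [eq_top_iff]
  intro y _
  obtain ⟨l, rfl⟩ := Submodule.mkQ_surjective _ y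
  exact (Submodule.eq_top_iff'.1 htop l :)

/-! ### Depth, generators of 𝔪 and the choice of x -/

/-- The depth of a finite module drops by at most one modulo a regular element. -/
theorem exists_isRegular_quotSMulTop {A : Type u} [CommRing A] [IsLocalRing A]
    [IsNoetherianRing A] (L : Type u) [AddCommGroup L] [Module A L] [Module.Finite A L]
    [Nontrivial L] {d : ℕ} (h : ∃ rs : List A, rs.length = d + 1 ∧ (∀ r ∈ rs, r ∈ maximalIdeal A) ∧
      RingTheory.Sequence.IsRegular L rs) {x : A} (hxm : x ∈ maximalIdeal A)
    (hx : IsSMulRegular L x) :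
    ∃ rs : List A, rs.length = d ∧ (∀ r ∈ rs, r ∈ maximalIdeal A) ∧
      RingTheory.Sequence.IsRegular (QuotSMulTop x L) rs := by
  have hsupp : Module.support A (ModuleCat.of A (A ⧸ maximalIdeal A)) =
      PrimeSpectrum.zeroLocus (maximalIdeal A : Set A) := by
    change Module.support A (A ⧸ maximalIdeal A) = _
    rw [Module.support_eq_zeroLocus, Ideal.annihilator_quotient]
  have hlt : ∀ (T : Type u) [AddCommGroup T] [Module A T] [Module.Finite A T] [Nontrivial T],
      maximalIdeal A • (⊤ : Submodule A T) < ⊤ := fun T _ _ _ _ =>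
    (Submodule.top_ne_ideal_smul_of_le_jacobson_annihilator
      (maximalIdeal_le_jacobson _)).symm.lt_top
  have := nontrivial_quotSMulTop_of_mem_maximalIdeal L hxm
  obtain ⟨rs, hlen, hmem, hreg⟩ := h
  -- x need not belong to the given sequence, so depth is read off Ext(k, -): Ext^i(k, L/xL) lies
  -- between Ext^i(k, L) and Ext^{i+1}(k, L), both zero for i < d.
  have hext := ModuleCat.subsingleton_ext_of_exists_isRegular (maximalIdeal A)
    (ModuleCat.of A (A ⧸ maximalIdeal A)) hsupp.subset (ModuleCat.of A L) (hlt L) rs hmem hreg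
  refine ModuleCat.exists_isRegular_of_exists_subsingleton_ext (maximalIdeal A) d
    (ModuleCat.of A (QuotSMulTop x L)) (hlt _) (ModuleCat.of A (A ⧸ maximalIdeal A)) hsupp ?_
  intro i hi
  refine subsingleton_of_forall_eq 0 fun z => ?_
  have hS := IsSMulRegular.smulShortComplex_shortExact (M := ModuleCat.of A L) hx
  have h2 : Subsingleton (Ext (ModuleCat.of A (A ⧸ maximalIdeal A))
    ((ModuleCat.of A L).smulShortComplex x).X₁ (i + 1)) := hext (i + 1) (by omega)
  have h1 : Subsingleton (Ext (ModuleCat.of A (A ⧸ maximalIdeal A))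
    ((ModuleCat.of A L).smulShortComplex x).X₂ i) := hext i (by omega)
  obtain ⟨w, hw⟩ := Ext.covariant_sequence_exact₃ _ hS z rfl (h2.elim _ _)
  rw [← hw, h1.elim w 0, Ext.zero_comp]
  rfl

/-- If `A ⧸ (x)` has maximal ideal generated by `d` elements, then the maximal ideal of `A` is
generated by `d + 1` elements. -/
theorem spanFinrank_maximalIdeal_le_of_quotient {A : Type u} [CommRing A] [IsLocalRing A]
    [IsNoetherianRing A] {x : A} (hxm : x ∈ maximalIdeal A) [IsLocalRing (A ⧸ Ideal.span {x})]
    (hmem : ∀ a, algebraMap A (A ⧸ Ideal.span {x}) a ∈ maximalIdeal (A ⧸ Ideal.span {x}) ↔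
      a ∈ maximalIdeal A) {d : ℕ} (h : (maximalIdeal (A ⧸ Ideal.span {x})).spanFinrank ≤ d) :
    (maximalIdeal A).spanFinrank ≤ d + 1 := by
  classical
  obtain ⟨t, ht, hspan⟩ := Submodule.FG.exists_span_finset_card_eq_spanFinrank
    ((isNoetherianRing_iff_ideal_fg _).1 inferInstance (maximalIdeal (A ⧸ Ideal.span {x})))
  choose σ hσ using Ideal.Quotient.mk_surjective (I := Ideal.span {x})
  have hgen : maximalIdeal A = Ideal.span (insert x (t.image σ) : Finset A) := by
    refine le_antisymm ?_ (Ideal.span_le.2 ?_)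
    · have hle : maximalIdeal (A ⧸ Ideal.span {x}) ≤
          (Ideal.span (insert x (t.image σ) : Finset A)).map (Ideal.Quotient.mk _) := by
        rw [← hspan]
        refine Submodule.span_le.2 fun c hc => ?_
        rw [← hσ c]
        exact Ideal.mem_map_of_mem _ (Ideal.subset_span
          (Finset.mem_coe.2 (Finset.mem_insert_of_mem (Finset.mem_image_of_mem _ hc))))
      intro a ha
      have h1 := hle ((hmem a).2 ha)
      rw [Ideal.Quotient.algebraMap_eq,
        Ideal.mem_map_iff_of_surjective _ Ideal.Quotient.mk_surjective] at h1
      obtain ⟨c, hc, hca⟩ := h1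
      rw [← sub_sub_cancel c a]
      refine sub_mem hc (Ideal.span_mono ?_ (Ideal.Quotient.eq.1 hca))
      simp
    · intro y hy
      rw [Finset.mem_coe, Finset.mem_insert, Finset.mem_image] at hy
      obtain rfl | ⟨c, hc, rfl⟩ := hy
      · exact hxm
      · refine (hmem _).1 ?_
        rw [Ideal.Quotient.algebraMap_eq, hσ, ← hspan]
        exact Submodule.subset_span hc
  have hcard : (maximalIdeal A).spanFinrank ≤ (insert x (t.image σ)).card := by
    rw [hgen, ← Set.ncard_coe_finset]
    exact Submodule.spanFinrank_span_le_ncard_of_finite (Finset.finite_toSet _)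
  have := Finset.card_insert_le x (t.image σ)
  have := Finset.card_image_le (s := t) (f := σ)
  omega

/-- Some element of `𝔪 \ 𝔪²` is regular on `A` and on `L` if both have positive depth. -/
theorem exists_isSMulRegular_notMem_sq {A : Type u} [CommRing A] [IsLocalRing A]
    [IsNoetherianRing A] (L : Type u) [AddCommGroup L] [Module A L] [Module.Finite A L]
    (hm : maximalIdeal A ≠ ⊥) (hA : maximalIdeal A ∉ associatedPrimes A A)
    (hL : maximalIdeal A ∉ associatedPrimes A L) :
    ∃ x ∈ maximalIdeal A, x ∉ maximalIdeal A ^ 2 ∧ IsSMulRegular A x ∧ IsSMulRegular L x := by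
  classical
  let s : Finset (Ideal A) := insert (maximalIdeal A ^ 2)
    ((associatedPrimes.finite A A).toFinset ∪ (associatedPrimes.finite A L).toFinset)
  have hnot : ¬ ((maximalIdeal A : Set A) ⊆ ⋃ i ∈ (s : Set (Ideal A)), (i : Set A)) := by
    -- Prime avoidance allows two exceptional ideals; 𝔪², the only member that may fail to be prime,
    -- fills both slots.
    rw [Ideal.subset_union_prime (f := fun i => i) (maximalIdeal A ^ 2) (maximalIdeal A ^ 2)]
    · rintro ⟨i, hi, hle⟩
      simp only [s, Finset.mem_insert, Finset.mem_union, Set.Finite.mem_toFinset] at hi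
      obtain rfl | hi | hi := hi
      · refine hm (Submodule.eq_bot_of_le_smul_of_le_jacobson_bot (maximalIdeal A) _
          ((isNoetherianRing_iff_ideal_fg A).1 inferInstance _) ?_ (maximalIdeal_le_jacobson _))
        rwa [smul_eq_mul, ← pow_two]
      · exact hA (((maximalIdeal.isMaximal A).eq_of_le hi.isPrime.ne_top hle) ▸ hi)
      · exact hL (((maximalIdeal.isMaximal A).eq_of_le hi.isPrime.ne_top hle) ▸ hi)
    · intro i hi hne _
      simp only [s, Finset.mem_insert, Finset.mem_union, Set.Finite.mem_toFinset] at hi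
      obtain hi | hi | hi := hi
      · exact absurd hi hne
      · exact hi.isPrime
      · exact hi.isPrime
  obtain ⟨x, hxm, hx⟩ := Set.not_subset.1 hnot
  simp only [Set.mem_iUnion, not_exists] at hx
  have hreg : ∀ (T : Type u) [AddCommGroup T] [Module A T],
      (∀ p ∈ associatedPrimes A T, p ∈ s) → IsSMulRegular T x := by
    intro T _ _ hT
    by_contra hcon
    have hmem : x ∈ {r : A | IsSMulRegular T r}ᶜ := hcon
    rw [← biUnion_associatedPrimes_eq_compl_regular A T] at hmem
    simp only [Set.mem_iUnion] at hmem
    obtain ⟨p, hp, hxp⟩ := hmem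
    exact hx p (Finset.mem_coe.2 (hT p hp)) hxp
  refine ⟨x, hxm, fun h => hx _ (Finset.mem_coe.2 (Finset.mem_insert_self _ _)) h,
    hreg A fun p hp => ?_, hreg L fun p hp => ?_⟩
  · simp [s, hp]
  · simp [s, hp]

theorem exists_socle_of_mem_associatedPrimes {A : Type u} [CommRing A] [IsLocalRing A]
    [IsNoetherianRing A]
    {M : Type u} [AddCommGroup M] [Module A M] (h : maximalIdeal A ∈ associatedPrimes A M) :
    ∃ y : M, y ≠ 0 ∧ ∀ m ∈ maximalIdeal A, m • y = 0 := by
  obtain ⟨hp, y, hy⟩ := Submodule.isAssociatedPrime_iff.1 (AssociatedPrimes.mem_iff.1 h)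
  refine ⟨y, ?_, fun m hm => ?_⟩
  · rintro rfl
    refine hp.ne_top (hy.trans ?_)
    rw [Ideal.eq_top_iff_one, Submodule.mem_colon_singleton, smul_zero]
    exact zero_mem _
  · rw [hy, Submodule.mem_colon_singleton] at hm
    exact hm

/-! ### Induction on the dimension -/

theorem exists_ringKrullDim_eq_natCast (A : Type u) [CommRing A] [IsLocalRing A]
    [IsNoetherianRing A] : ∃ d : ℕ, ringKrullDim A = d := by
  obtain ⟨e, he⟩ := WithBot.ne_bot_iff_exists.1 (ringKrullDim_ne_bot (R := A))
  have he' : e ≠ ⊤ := by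
    rintro rfl
    exact ringKrullDim_ne_top (R := A) he.symm
  obtain ⟨d, rfl⟩ := ENat.ne_top_iff_exists.1 he'
  exact ⟨d, he.symm⟩

/-- A and L are quantified after d because the inductive step changes the ring. All four conditions
pass to A/(x) and L/xL with d lowered by one. -/
theorem spanFinrank_maximalIdeal_le (d : ℕ) :
    ∀ (A : Type u) [CommRing A] [IsLocalRing A] [IsNoetherianRing A]
      (L : Type u) [AddCommGroup L] [Module A L] [Module.Finite A L] [Nontrivial L] (s : ℕ),
      ringKrullDim A ≤ d →
      (∃ rs : List A, rs.length = d ∧ (∀ r ∈ rs, r ∈ maximalIdeal A) ∧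
        RingTheory.Sequence.IsRegular L rs) →
      HasInjectiveDimensionLE (ModuleCat.of A L) s → IsSpannedBySyzygies A L →
      (maximalIdeal A).spanFinrank ≤ d := by
  induction d with
  | zero =>
    intro A _ _ _ L _ _ _ _ s hdim _ hinj hspan
    by_contra hcon
    have hm : maximalIdeal A ≠ ⊥ := fun h => hcon (by rw [h, Submodule.spanFinrank_bot])
    have : Ring.KrullDimLE 0 A := by
      rw [Ring.KrullDimLE, Order.krullDimLE_iff, ← ringKrullDim]
      exact hdim
    have hart := IsNoetherianRing.isArtinianRing_of_krullDimLE_zero (R := A)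
    have hnil := (isArtinianRing_iff_isNilpotent_maximalIdeal A).1 hart
    -- a comes from the last nonzero power of 𝔪; its exponent is positive because 𝔪 ≠ 0, so a ∈ 𝔪.
    obtain ⟨a, ha, ha0, hma⟩ : ∃ a ∈ maximalIdeal A, a ≠ 0 ∧
        ∀ y ∈ maximalIdeal A, y * a = 0 := by
      classical
      have hk : maximalIdeal A ^ Nat.find hnil = 0 := Nat.find_spec hnil
      rcases hk' : Nat.find hnil with _ | _ | k
      · rw [hk', pow_zero] at hk
        exact absurd hk one_ne_zero
      · rw [hk', zero_add, pow_one] at hk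
        exact absurd hk hm
      · have hne : maximalIdeal A ^ (k + 1) ≠ ⊥ := Nat.find_min hnil (by omega)
        obtain ⟨a, ha, ha0⟩ := Submodule.exists_mem_ne_zero_of_ne_bot hne
        refine ⟨a, Ideal.pow_le_self (by omega) ha, ha0, fun y hy => ?_⟩
        have : y * a ∈ maximalIdeal A ^ (k + 1 + 1) := by
          rw [pow_succ' _ (k + 1)]
          exact Ideal.mul_mem_mul hy ha
        rw [← hk', hk] at this
        exact this
    have hf : Module.Finite A (ModuleCat.of A L) := ‹Module.Finite A L›
    have hnt : Nontrivial (ModuleCat.of A L) := ‹Nontrivial L›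
    obtain ⟨hext, y, hy0, hy⟩ := ext_one_and_socle_of_depth_zero (ModuleCat.of A L) (s + 1) a ha0 hma
    have haL : ∀ l : L, a • l = 0 := by
      intro l
      have htop := hspan (LinearMap.ker (LinearMap.lsmul A L a)) fun n S hS f z => by
        rw [LinearMap.mem_ker, LinearMap.lsmul_apply, ← map_smul, hS.smul_eq_zero ha hma,
          map_zero]
      have : l ∈ LinearMap.ker (LinearMap.lsmul A L a) := htop ▸ trivial
      exact this
    -- The annihilator of a lies in 𝔪, which kills y, so a ↦ y is well defined on (a). Extending it
    -- to A gives y = a l = 0.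
    have hwd : ∀ c c' : A, c * a = c' * a → c • y = c' • y := by
      intro c c' h
      rw [← sub_eq_zero, ← sub_smul]
      refine hy _ (IsLocalRing.le_maximalIdeal (J := LinearMap.ker
        (LinearMap.toSpanSingleton A A a)) ?_ ?_)
      · intro h
        have : (1 : A) ∈ LinearMap.ker (LinearMap.toSpanSingleton A A a) := h ▸ trivial
        exact ha0 (by simpa using this)
      · simp [sub_mul, h]
    choose c hc using fun z : Ideal.span {a} => Ideal.mem_span_singleton'.1 z.2
    let g : Ideal.span {a} →ₗ[A] ModuleCat.of A L :=
      { toFun := fun z => c z • y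
        map_add' := fun z z' => by
          rw [← add_smul]
          exact hwd _ _ (by rw [add_mul, hc, hc, hc]; rfl)
        map_smul' := fun b z => by
          rw [RingHom.id_apply, smul_smul]
          exact hwd _ _ (by rw [mul_assoc, hc, hc]; rfl) }
    obtain ⟨l, hl⟩ := exists_extension_of_subsingleton_ext_one (ModuleCat.of A L) hext _ g
    refine hy0 ?_
    have h1 := hl ⟨a, Ideal.mem_span_singleton_self a⟩
    have h2 : c ⟨a, Ideal.mem_span_singleton_self a⟩ • y = (1 : A) • y :=
      hwd _ _ (by rw [hc, one_mul])
    rw [one_smul] at h2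
    exact h2.symm.trans (h1.trans (haL l))
  | succ d ih =>
    intro A _ _ _ L _ _ _ _ s hdim hdepth hinj hspan
    by_cases hm : maximalIdeal A = ⊥
    · rw [hm, Submodule.spanFinrank_bot]
      exact Nat.zero_le _
    have hLsoc : ¬ ∃ y : L, y ≠ 0 ∧ ∀ m ∈ maximalIdeal A, m • y = 0 := by
      rintro ⟨y, hy0, hy⟩
      obtain ⟨rs, hlen, hmem, hreg⟩ := hdepth
      match rs with
      | r :: rs =>
        rw [RingTheory.Sequence.isRegular_cons_iff] at hreg
        exact hy0 (hreg.1.right_eq_zero_of_smul (hy r (hmem r List.mem_cons_self)))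
    have hf : Module.Finite A (ModuleCat.of A L) := ‹Module.Finite A L›
    have hnt : Nontrivial (ModuleCat.of A L) := ‹Nontrivial L›
    -- A socle element of A would force one in L, so neither A nor L has 𝔪 as an associated prime.
    obtain ⟨x, hxm, hx2, hxA, hxL⟩ := exists_isSMulRegular_notMem_sq L hm
      (fun h => by
        obtain ⟨a, ha0, hma⟩ := exists_socle_of_mem_associatedPrimes h
        exact hLsoc (ext_one_and_socle_of_depth_zero (ModuleCat.of A L) (s + 1) a ha0 hma).2)
      (fun h => hLsoc (exists_socle_of_mem_associatedPrimes h))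
    have : Nontrivial (A ⧸ Ideal.span {x}) := Ideal.Quotient.nontrivial_iff.2 fun h =>
      (maximalIdeal.isMaximal A).ne_top (top_le_iff.1 (h ▸ (Ideal.span_singleton_le_iff_mem _).2 hxm))
    have hB : Function.Surjective (algebraMap A (A ⧸ Ideal.span {x})) :=
      Ideal.Quotient.mk_surjective
    have hloc : IsLocalRing (A ⧸ Ideal.span {x}) := IsLocalRing.of_surjective' _ hB
    have hlh : IsLocalHom (algebraMap A (A ⧸ Ideal.span {x})) := IsLocalHom.of_surjective _ hB
    have hmem : ∀ a, algebraMap A (A ⧸ Ideal.span {x}) a ∈ maximalIdeal (A ⧸ Ideal.span {x}) ↔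
        a ∈ maximalIdeal A := fun a => by
      rw [mem_maximalIdeal, mem_maximalIdeal, mem_nonunits_iff, mem_nonunits_iff,
        isUnit_map_iff]
    refine spanFinrank_maximalIdeal_le_of_quotient hxm hmem ?_
    have : Nontrivial (QuotSMulTop x L) := nontrivial_quotSMulTop_of_mem_maximalIdeal L hxm
    have : Module.Finite (A ⧸ Ideal.span {x}) (QuotSMulTop x L) :=
      Module.Finite.of_restrictScalars_finite A _ _
    refine ih (A ⧸ Ideal.span {x}) (QuotSMulTop x L) s ?_ ?_ ?_
      (hspan.quotSMulTop hmem hxA hx2)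
    · have h1 := ringKrullDim_quotient_succ_le_of_nonZeroDivisor (r := x) (by
        rw [mem_nonZeroDivisors_iff_right]
        intro z hz
        exact hxA.right_eq_zero_of_smul (by rwa [smul_eq_mul, mul_comm]))
      have h2 := h1.trans hdim
      obtain ⟨e, he⟩ := exists_ringKrullDim_eq_natCast (A ⧸ Ideal.span {x})
      rw [he] at h2 ⊢
      exact_mod_cast Nat.le_of_succ_le_succ (by exact_mod_cast h2)
    · obtain ⟨rs, hlen, hrs, hreg⟩ := exists_isRegular_quotSMulTop L hdepth hxm hxL
      have hrs' : ∀ r ∈ rs.map (algebraMap A (A ⧸ Ideal.span {x})),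
          r ∈ maximalIdeal (A ⧸ Ideal.span {x}) := by
        intro r hr
        obtain ⟨c, hc, rfl⟩ := List.mem_map.1 hr
        exact (hmem c).2 (hrs c hc)
      exact ⟨rs.map (algebraMap A _), by rw [List.length_map, hlen], hrs',
        .of_isWeaklyRegular_of_mem_maximalIdeal _ hrs'
          ((RingTheory.Sequence.isWeaklyRegular_map_algebraMap_iff _ _ rs).2 hreg.1)⟩
    -- The bound s is first weakened to s + 1, so it is again s after reduction and s = 0 needs no
    -- separate case.
    · exact hasInjectiveDimensionLE_quotSMulTop hxA s L hxL
        (hasInjectiveDimensionLT_of_ge _ (s + 1) _ (by omega))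

/-! ### Syzygies of the residue field and the conclusion -/

theorem MinimalFreeResolution.isIteratedSyzygy {A : Type u} [CommRing A] [IsLocalRing A]
    (F : MinimalFreeResolution A (ResidueField A)) (n : ℕ) :
    IsIteratedSyzygy A n (F.syzygy n) := by
  induction n with
  | zero =>
    refine ⟨inferInstanceAs (Module.Finite A (ResidueField A)), fun a ha (y : ResidueField A) => ?_⟩
    change a • y = 0
    rw [Algebra.smul_def, ResidueField.algebraMap_eq, (residue_eq_zero_iff a).2 ha, zero_mul]
  | succ n ih =>
    cases n with
    | zero =>
      refine ⟨F.rank 0, _, (LinearMap.range (F.d 0)).subtype, F.aug, Subtype.val_injective, ?_,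
        F.aug_surjective, ?_, ih⟩
      · intro v
        exact (F.exact_zero v).trans ⟨fun ⟨y, hy⟩ => ⟨⟨v, y, hy⟩, rfl⟩,
          fun ⟨⟨_, y, hy⟩, h⟩ => ⟨y, hy.trans h⟩⟩
      · rintro ⟨_, ⟨w, rfl⟩⟩ i
        exact F.minimal 0 w i
    | succ n =>
      refine ⟨F.rank (n + 1), _, (LinearMap.range (F.d (n + 1))).subtype, (F.d n).rangeRestrict,
        Subtype.val_injective, ?_, (F.d n).surjective_rangeRestrict, ?_, ih⟩
      · intro v
        exact Subtype.ext_iff.trans ((F.exact_succ n v).trans ⟨fun ⟨y, hy⟩ => ⟨⟨v, y, hy⟩, rfl⟩,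
          fun ⟨⟨_, y, hy⟩, h⟩ => ⟨y, hy.trans h⟩⟩)
      · rintro ⟨_, ⟨w, rfl⟩⟩ i
        exact F.minimal (n + 1) w i

theorem mainTheorem10 (A : Type u) [CommRing A] [IsLocalRing A] [IsNoetherianRing A]
    (F : MinimalFreeResolution A (ResidueField A))
    (Λ : Finset ℕ) (j : ℕ → ℕ)
    (L : Type u) [AddCommGroup L] [Module A L] [Nontrivial L]
    (hMCM : IsMaximalCohenMacaulay A L)
    (hinj : CategoryTheory.injectiveDimension (ModuleCat.of A L) ≠ ⊤)
    (f : DirectSum Λ (fun n => Fin (j n) → F.syzygy n) →ₗ[A] L)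
    (hf : Function.Surjective f) :
    IsRegularLocalRing A := by
  classical
  have := hMCM.finite
  obtain ⟨s, hs⟩ := (injectiveDimension_ne_top_iff _).1 hinj
  obtain ⟨d, hd⟩ : ∃ d : ℕ, ringKrullDim A = d := exists_ringKrullDim_eq_natCast A
  have hdepth : localDepth A L = d := by
    have h := (hMCM.depth_eq inferInstance).trans ((hMCM.dim_eq inferInstance).trans hd)
    exact_mod_cast h
  refine IsRegularLocalRing.of_spanFinrank_maximalIdeal_le A ?_
  rw [hd]
  refine Nat.cast_le.2 (spanFinrank_maximalIdeal_le d A L s hd.le ?_ hs ?_)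
  · obtain _ | d := d
    · exact ⟨[], rfl, by simp, .nil A L⟩
    -- Depth is a supremum, here equal to d + 1: some regular sequence is longer than d, and none is
    -- longer than d + 1.
    · have hlt : (d : ℕ∞) < localDepth A L := by
        rw [hdepth]
        exact_mod_cast Nat.lt_succ_self d
      obtain ⟨rs, hrs⟩ := lt_iSup_iff.1 hlt
      obtain ⟨⟨hmem, hreg⟩, hlen⟩ := lt_iSup_iff.1 hrs
      refine ⟨rs, le_antisymm ?_ (Nat.succ_le_of_lt (by exact_mod_cast hlen)), hmem, hreg⟩
      have hle : (rs.length : ℕ∞) ≤ localDepth A L :=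
        le_iSup₂_of_le (f := fun (rs : List A) (_ : (∀ r ∈ rs, r ∈ maximalIdeal A) ∧
          RingTheory.Sequence.IsRegular L rs) => (rs.length : ℕ∞)) rs ⟨hmem, hreg⟩ le_rfl
      rw [hdepth] at hle
      exact_mod_cast hle
  · intro W hW
    rw [eq_top_iff]
    intro l _
    obtain ⟨z, rfl⟩ := hf l
    induction z using DirectSum.induction_on with
    | zero => rw [map_zero]; exact zero_mem _
    | add y z hy hz => rw [map_add]; exact add_mem (hy trivial) (hz trivial)
    | of i y =>
      rw [← Finset.univ_sum_single y, map_sum, map_sum]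
      refine sum_mem fun k _ => ?_
      exact hW i (F.syzygy i) (F.isIteratedSyzygy i)
        (f ∘ₗ DirectSum.lof A Λ (fun n => Fin (j n) → F.syzygy n) i ∘ₗ
          LinearMap.single A (fun _ => F.syzygy i) k) (y k)
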